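/- Let $\mathcal X,\mathcal Y$ be measurable spaces, $\mathcal Z=\mathcal X\times\mathcal Y$, and let $\mathcal M$ be the set of probability measures on $\mathcal Z$, with the $\sigma$-algebra generated by the evaluations $P\mapsto P(A)$. Let $\mu$ be a meta-distribution, i.e. a probability measure on $\mathcal M$. Let $h:\mathcal X\to\mathcal Y$ be a model and $\ell:\mathcal Y\times\mathcal Y\to[0,1]$ a loss such that $(x,y)\mapsto\ell(y,h(x))$ is measurable (for instance, $\ell$ and $h$ measurable). Let $K\ge 1$ and $n_1,\dots,n_K\ge 1$. Let $P_1,\dots,P_K$ be independent samples from $\mu$ and let $D_k=\{(x^{(k)}_i,y^{(k)}_i)\}_{i=1}^{n_k}$ be a dataset which, given $P_k$, consists of $n_k$ independent samples from $P_k$, the pairs $(P_k,D_k)$, $k=1,\dots,K$, being independent. Let $\widehat P_k$ be the empirical distribution of $D_k$ and $$\widehat{\mathsf{QV}}_k(h)=\mathbb E_{\widehat P_k}[\ell(y,h(x))]=\frac1{n_k}\sum_{i=1}^{n_k}\ell\big(y^{(k)}_i,h(x^{(k)}_i)\big).$$ There is a universal constant $C>0$ (independent of the spaces, $\mu$, $h$,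 $\ell$, $K$, the $n_k$ and $\delta$) such that for every $\delta>0$ the following hold. 1. With probability at least $1-\delta$, $$\mathbb E_{P\sim\mu}\big[\mathbb E_P[\ell(y,h(x))]\big]\le\frac1K\sum_{k=1}^K\widehat{\mathsf{QV}}_k(h)+C\sqrt{\log(K/\delta)}\left(\frac1{\sqrt K}+\frac1K\sum_{k=1}^K n_k^{-1/2}\right).$$ 2. With probability at least $1-\delta$, simultaneously for all $\lambda\in\mathbb R$, $$\mu\big(\{P:\mathbb E_P[\ell(y,h(x))]\ge\lambda\}\big)\le\frac1K\sum_{k=1}^K\mathbf 1\!\left(\widehat{\mathsf{QV}}_k(h)\ge\lambda-\sqrt{\frac{\log\frac{K+1}{\delta}}{2n_k}}\right)+\sqrt{\frac{\log\frac{2(K+1)}{\delta}}{2K}}.$$ (For $\delta>1$ both claims are trivial, and the square root of a negative number is read as $0$.) -/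

import Mathlib

open MeasureTheory ProbabilityTheory
open scoped ENNReal

noncomputable section

/-- The kernel sending a probability measure `P` to `P^{⊗ n}`, the law of `n` independent samples
from `P`. -/
def iidKernel (Z : Type*) [MeasurableSpace Z] (n : ℕ) :
    Kernel (ProbabilityMeasure Z) (Fin n → Z) where
  toFun P := Measure.pi fun _ : Fin n => (P : Measure Z)
  measurable' := by
    refine Measurable.measure_of_isPiSystem_of_isProbabilityMeasure
      (S := Set.pi Set.univ '' Set.pi Set.univ fun _ : Fin n => {s : Set Z | MeasurableSet s})
      generateFrom_pi.symm isPiSystem_pi ?_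
    rintro _ ⟨s, hs, rfl⟩
    simp only [Measure.pi_pi]
    exact Finset.measurable_prod _ fun i _ =>
      (Measure.measurable_coe (hs i (Set.mem_univ i))).comp measurable_subtype_coe

/-- The joint law of one client: a data distribution `P` drawn from the meta-distribution `μ`,
together with a dataset of `n` points that, given `P`, are independent samples from `P`. -/
def clientLaw {Z : Type*} [MeasurableSpace Z] (μ : Measure (ProbabilityMeasure Z)) (n : ℕ) :
    Measure (ProbabilityMeasure Z × (Fin n → Z)) :=
  μ ⊗ₘ iidKernel Z n

/-- The empirical distribution `(1/n) ∑ i, δ_{D i}` of a dataset. -/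
def empiricalDistribution {Z : Type*} [MeasurableSpace Z] {n : ℕ} (D : Fin n → Z) : Measure Z :=
  (n : ℝ≥0∞)⁻¹ • ∑ i, Measure.dirac (D i)

/-- The risk `E_P[ℓ(y, h(x))]` of the model `h` on the data distribution `P`. -/
def risk {X Y : Type*} [MeasurableSpace X] [MeasurableSpace Y] (loss : Y → Y → ℝ) (h : X → Y)
    (P : Measure (X × Y)) : ℝ :=
  ∫ z, loss z.2 (h z.1) ∂P

/-- The non-robust query value a client with dataset `D` returns: its risk under the empirical
distribution (the robustness radius is zero). -/
def queryValue {X Y : Type*} [MeasurableSpace X] [MeasurableSpace Y] (loss : Y → Y → ℝ)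
    (h : X → Y) {n : ℕ} (D : Fin n → X × Y) : ℝ :=
  risk loss h (empiricalDistribution D)

end

/-!
The mean risk. The query values are independent, lie in `[0, 1]`, and by conditioning on `P k` each
of them has mean `∫ risk dμ`. Hoeffding's inequality over the `K` clients gives the claim with
`C = 1`; the within-client error terms are not needed (`measureReal_sum_queryValue_le_le_exp`).

The tail of the risk. Write `S t = μ {risk ≥ t}`, `p = δ / (K + 1)`, and let `ε` be the last square
root of the claim, so that `exp (-2 K ε²) = p / 2`. Call client `k` good if its query value is at
least its risk minus `√(log (1 / p) / (2 n k))`; given `P k` this fails with probability at most `p`,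
by Hoeffding's inequality within the client (`smul_le_map_fst_restrict_clientLaw`). A good client
with risk at least `t` is counted in the claim at threshold `t`, so it suffices to compare `S t` with
the fraction of good clients of risk at least `t`.

A union bound over the clients plus the Dvoretzky–Kiefer–Wolfowitz inequality with Massart's constant
would do, but that inequality is avoided. If the bound fails, then for some natural number
`j < K (1 - ε)` there is `t` with `S t > j / K + ε` and at most `j` clients counted. For fixed `j`
these events increase with `t`, so the probability of their union is the supremum of their
probabilities, each a lower tail of a sum of independent indicators. This costs a factor
`⌈K (1 - ε)⌉` and nothing else (`measureReal_exists_count_add_lt_le`). The factor is affordable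
because the failures of the clients need not be paid for by a union bound
(`measureReal_exists_thinned_count_add_lt_le`):

* for `δ ≤ 2 / 3` the indicators of "good and of risk at least `t`" are used directly. Their means
  are at least `(1 - p) S t`, and the loss in Hoeffding's exponent is absorbed by
  `(1 - x) exp (4 δ x) ≤ 2` with `x = ε K / (K + 1)`;
* for `δ ≥ 2 / 3` the joint law of the `P k`, restricted to all clients being good, dominates
  `(1 - p) ^ K` times the product of the `μ` (`smul_pi_le_pi`). So the claim holds with probability
  at least `(1 - p) ^ K (1 - δ / 2) ≥ exp (-δ) (1 - δ / 2) ≥ 1 - δ`.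
-/

/-! ### Hoeffding's inequality and counts exceeding a threshold -/

/-- Hoeffding's inequality for the lower tail of a sum of independent `[0, 1]`-valued variables. -/
theorem measureReal_sum_le_sub_le_exp {Ω ι : Type*} [MeasurableSpace Ω] [Fintype ι]
    {Pr : Measure Ω} [IsProbabilityMeasure Pr] {Z : ι → Ω → ℝ}
    (hZ : ∀ i, AEMeasurable (Z i) Pr) (hb : ∀ i ω, Z i ω ∈ Set.Icc (0 : ℝ) 1)
    (hind : iIndepFun Z Pr) {s : ℝ} (hs : 0 ≤ s) :
    Pr.real {ω | ∑ i, Z i ω ≤ ∑ i, ∫ ω, Z i ω ∂Pr - s} ≤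
      Real.exp (-2 * s ^ 2 / Fintype.card ι) := by
  have hsub : ∀ i ∈ Finset.univ,
      HasSubgaussianMGF (fun ω => -(Z i ω - ∫ ω, Z i ω ∂Pr)) (1 / 4) Pr := by
    intro i _
    have h := (hasSubgaussianMGF_of_mem_Icc (hZ i) (ae_of_all _ (hb i))).neg
    have hc : ((‖(1 : ℝ) - 0‖₊ / 2) ^ 2 : NNReal) = 1 / 4 := by
      rw [sub_zero, nnnorm_one, div_pow]
      norm_num
    rwa [hc] at h
  have hind' : iIndepFun (fun i ω => -(Z i ω - ∫ ω, Z i ω ∂Pr)) Pr :=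
    hind.comp (fun i x => -(x - ∫ ω, Z i ω ∂Pr)) fun i => by fun_prop
  have h := HasSubgaussianMGF.measure_sum_ge_le_of_iIndepFun hind' hsub hs
  convert h using 2
  · ext ω
    simp only [Set.mem_ofPred_eq, Finset.sum_neg_distrib, Finset.sum_sub_distrib]
    constructor <;> intro h <;> linarith
  · simp only [Finset.sum_const, Finset.card_univ, nsmul_eq_mul]
    push_cast
    rcases eq_or_ne (Fintype.card ι : ℝ) 0 with h0 | h0
    · simp [h0]
    · field_simp
      ring

/-- A one-sided uniform deviation bound for independent, not identically distributed, decreasing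
families of events whose probabilities are at least `(1 - p) * S t`. For each value `j` of the count
only the supremum over the thresholds matters, since the events are directed in `t`; the prefactor is
the number of values of `j` for which a deviation is possible. -/
theorem measureReal_exists_count_add_lt_le {K : ℕ} (hK : 0 < K) {α : Fin K → Type*}
    [∀ k, MeasurableSpace (α k)] (ν : ∀ k, Measure (α k)) [∀ k, IsProbabilityMeasure (ν k)]
    {A : ∀ k, ℝ → Set (α k)} (hA : ∀ k t, MeasurableSet (A k t)) (hanti : ∀ k, Antitone (A k))
    {S : ℝ → ℝ} (hS : Antitone S) (hS1 : ∀ t, S t ≤ 1) {p ε : ℝ} (hε : 0 ≤ ε)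
    (hp0 : 0 ≤ p) (hAS : ∀ k t, (1 - p) * S t ≤ (ν k).real (A k t)) :
    (Measure.pi ν).real {x | ∃ t, (1 / (K : ℝ)) * ∑ k, (A k t).indicator (fun _ => (1 : ℝ)) (x k) + ε
      < S t} ≤ ⌈(K : ℝ) * (1 - ε)⌉₊ * Real.exp (-2 * K * ε ^ 2 + 4 * K * ε * p) := by
  have hK' : (0 : ℝ) < K := by exact_mod_cast hK
  set c : ℝ → (∀ k, α k) → ℝ := fun t x => ∑ k, (A k t).indicator (fun _ => (1 : ℝ)) (x k) with hc
  -- the number of exceedances is decreasing in the threshold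
  have hcanti : ∀ x, Antitone fun t => c t x := fun x t t' htt =>
    Finset.sum_le_sum fun k _ =>
      Set.indicator_le_indicator_of_subset (hanti k htt) (fun _ => zero_le_one) _
  have hcnat : ∀ t x, ∃ m : ℕ, c t x = m := by
    intro t x
    classical
    refine ⟨∑ k, if x k ∈ A k t then 1 else 0, ?_⟩
    simp [hc, Set.indicator_apply]
  -- a single threshold, by Hoeffding's inequality
  have hone : ∀ (j : ℕ) (t : ℝ), (j : ℝ) / K + ε < S t →
      (Measure.pi ν).real {x | c t x ≤ j} ≤
        Real.exp (-2 * K * ε ^ 2 + 4 * K * ε * p) := by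
    intro j t hjt
    -- for `ε < p` the exponent is nonnegative, so the right-hand side is at least `1`
    rcases lt_or_ge ε p with hεp | hεp
    · refine measureReal_le_one.trans (Real.one_le_exp ?_)
      have : 0 ≤ K * ε * (2 * p - ε) :=
        mul_nonneg (by positivity) (by linarith)
      nlinarith
    have hind : iIndepFun (fun k (x : ∀ k, α k) =>
        (A k t).indicator (fun _ => (1 : ℝ)) (x k)) (Measure.pi ν) :=
      iIndepFun_pi (X := fun k => (A k t).indicator fun _ => (1 : ℝ))
        fun k => (measurable_const.indicator (hA k t)).aemeasurable
    have h := measureReal_sum_le_sub_le_exp (s := K * (ε - p))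
      (Z := fun k (x : ∀ k, α k) => (A k t).indicator (fun _ => (1 : ℝ)) (x k)) (fun k =>
        ((measurable_const.indicator (hA k t)).comp (measurable_pi_apply k)).aemeasurable)
      (fun k x => ⟨Set.indicator_nonneg (fun _ _ => zero_le_one) _,
        Set.indicator_le_self' (fun _ _ => zero_le_one) _⟩) hind
      (mul_nonneg hK'.le (by linarith))
    have hint : ∀ k, ∫ x, (A k t).indicator (fun _ => (1 : ℝ)) (x k) ∂Measure.pi ν =
        (ν k).real (A k t) := by
      intro k
      rw [integral_comp_eval (μ := ν) (i := k)
        (f := (A k t).indicator fun _ => (1 : ℝ))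
        (measurable_const.indicator (hA k t)).aestronglyMeasurable]
      exact integral_indicator_one (hA k t)
    simp only [hint, Fintype.card_fin] at h
    refine (measureReal_mono ?_).trans (h.trans (Real.exp_le_exp.2 ?_))
    · intro x hx
      have h1 : (K : ℝ) * ((1 - p) * S t) ≤ ∑ k, (ν k).real (A k t) := by
        simpa using Finset.sum_le_sum (s := Finset.univ) fun k _ => hAS k t
      have h2 : (j : ℝ) + K * ε ≤ K * S t := by
        have := mul_le_mul_of_nonneg_left hjt.le hK'.le
        rwa [mul_add, mul_div_cancel₀ _ hK'.ne'] at this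
      have h3 : K * (p * S t) ≤ K * p := by
        have := mul_le_mul_of_nonneg_left (hS1 t) hp0
        nlinarith
      have hx' : c t x ≤ j := hx
      change c t x ≤ _
      nlinarith
    · have : -2 * (K * (ε - p)) ^ 2 / K = -2 * K * (ε - p) ^ 2 := by field_simp
      rw [this]
      nlinarith [mul_nonneg hK'.le (sq_nonneg p)]
  -- all the thresholds with tail above a given level: the events increase with the threshold
  have hall : ∀ j : ℕ, (Measure.pi ν).real {x | ∃ t, (j : ℝ) / K + ε < S t ∧ c t x ≤ j} ≤
        Real.exp (-2 * K * ε ^ 2 + 4 * K * ε * p) := by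
    intro j
    set I : Set ℝ := {t | (j : ℝ) / K + ε < S t} with hI
    -- makes `atTop` on the subtype `I` countably generated, as continuity of the measure requires
    have hord : I.OrdConnected := by
      refine ⟨fun a _ b hb t ht => lt_of_lt_of_le hb (hS ht.2)⟩
    have heq : {x | ∃ t, (j : ℝ) / K + ε < S t ∧ c t x ≤ j} = ⋃ t : I, {x | c t x ≤ j} := by
      ext x
      simp [hI]
    have hmono : Monotone fun t : I => {x | c t x ≤ j} :=
      fun t t' htt x hx => (hcanti x htt).trans hx
    rw [heq, measureReal_def, hmono.measure_iUnion]
    refine ENNReal.toReal_le_of_le_ofReal (Real.exp_pos _).le (iSup_le fun t => ?_)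
    rw [← ofReal_measureReal]
    exact ENNReal.ofReal_le_ofReal (hone j t t.2)
  have hsub : {x | ∃ t, (1 / (K : ℝ)) * c t x + ε < S t} ⊆
      ⋃ j ∈ Finset.range ⌈(K : ℝ) * (1 - ε)⌉₊, {x | ∃ t, (j : ℝ) / K + ε < S t ∧ c t x ≤ j} := by
    rintro x ⟨t, ht⟩
    obtain ⟨m, hm⟩ := hcnat t x
    have ht' : (m : ℝ) / K + ε < S t := by
      rw [← hm]
      convert ht using 2
      ring
    refine Set.mem_biUnion (x := m) ?_ ⟨t, ht', hm.le⟩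
    simp only [Finset.coe_range, Set.mem_Iio]
    rw [Nat.lt_ceil]
    have := ht'.trans_le (hS1 t)
    rw [← lt_sub_iff_add_lt, div_lt_iff₀ hK'] at this
    linarith
  calc _ ≤ (Measure.pi ν).real (⋃ j ∈ Finset.range ⌈(K : ℝ) * (1 - ε)⌉₊,
          {x | ∃ t, (j : ℝ) / K + ε < S t ∧ c t x ≤ j}) := measureReal_mono hsub (measure_ne_top _ _)
    _ ≤ ∑ j ∈ Finset.range ⌈(K : ℝ) * (1 - ε)⌉₊,
          (Measure.pi ν).real {x | ∃ t, (j : ℝ) / K + ε < S t ∧ c t x ≤ j} :=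
        measureReal_biUnion_finset_le _ _
    _ ≤ _ := by
        refine (Finset.sum_le_sum fun j _ => hall j).trans ?_
        simp

/-! ### Domination of product measures -/

/-- Setwise domination passes to finite products: `Measure.pi` is the restriction to measurable sets
of the largest outer measure bounded by the products on boxes, and the inequality holds on boxes. -/
theorem smul_pi_le_pi {ι : Type*} [Fintype ι] {α : ι → Type*} [∀ i, MeasurableSpace (α i)]
    (μ ν : ∀ i, Measure (α i)) [∀ i, SigmaFinite (μ i)] {c : ℝ≥0∞}
    (h : ∀ i, c • μ i ≤ ν i) : c ^ Fintype.card ι • Measure.pi μ ≤ Measure.pi ν := by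
  refine Measure.le_iff.2 fun s hs => ?_
  have hν : Measure.pi ν s = OuterMeasure.pi (fun i => (ν i).toOuterMeasure) s := by
    rw [Measure.pi_def, toMeasure_apply _ _ hs]
  rw [hν]
  refine (OuterMeasure.le_pi (n := (c ^ Fintype.card ι • Measure.pi μ).toOuterMeasure)).2
    (fun t _ => ?_) s
  simp only [Measure.coe_toOuterMeasure, Measure.smul_apply, Measure.pi_pi, smul_eq_mul]
  rw [← Finset.card_univ, ← Finset.prod_const, ← Finset.prod_mul_distrib]
  exact Finset.prod_le_prod' fun i _ => h i (t i)

/-! ### Uniform deviations under thinning -/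

/-- Bounds the price of the thinning when `δ ≤ 2 / 3`. At `δ = 2 / 3` the maximum over `x` is
`3 / 8 * exp (5 / 3)`, just below `2`. -/
theorem one_sub_mul_exp_le_two {δ x : ℝ} (hδ : δ ≤ 2 / 3) (hx : 0 ≤ x) :
    (1 - x) * Real.exp (4 * δ * x) ≤ 2 := by
  have h5 : Real.exp (5 / 3) ≤ 16 / 3 := by
    have h : Real.exp (5 / 3) ^ 3 ≤ (16 / 3) ^ 3 := by
      rw [← Real.exp_nat_mul]
      have h1 : Real.exp ((3 : ℕ) * (5 / 3)) = Real.exp 1 ^ 5 := by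
        rw [← Real.exp_nat_mul]
        norm_num
      rw [h1]
      calc Real.exp 1 ^ 5 ≤ 2.7182818286 ^ 5 := by
            gcongr
            exact Real.exp_one_lt_d9.le
        _ ≤ _ := by norm_num
    exact le_of_pow_le_pow_left₀ (by norm_num) (by norm_num) h
  -- the tangent line of the exponential at the maximum of `(1 - x) * exp (8 / 3 * x)`
  have htan : 8 / 3 * (1 - x) ≤ Real.exp (5 / 3 - 8 / 3 * x) := by
    linarith [Real.add_one_le_exp (5 / 3 - 8 / 3 * x)]
  rcases le_or_gt 1 x with h1 | h1
  · exact (mul_nonpos_of_nonpos_of_nonneg (by linarith) (Real.exp_pos _).le).trans (by norm_num)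
  calc (1 - x) * Real.exp (4 * δ * x) ≤ (1 - x) * Real.exp (8 / 3 * x) := by
        refine mul_le_mul_of_nonneg_left (Real.exp_le_exp.2 ?_) (by linarith)
        nlinarith
    _ ≤ (3 / 8 * Real.exp (5 / 3 - 8 / 3 * x)) * Real.exp (8 / 3 * x) := by
        gcongr
        linarith
    _ = 3 / 8 * Real.exp (5 / 3) := by
        rw [mul_assoc, ← Real.exp_add]
        ring_nf
    _ ≤ 2 := by linarith

/-- The numerical fact behind the case `2 / 3 ≤ δ`: the right-hand side is at least
`exp (-δ) * (1 - δ / 2)`. -/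
theorem one_sub_le_pow_mul {δ : ℝ} {K : ℕ} (hK : 0 < K) (hδ : 2 / 3 ≤ δ) (hδ1 : δ ≤ 1) :
    1 - δ ≤ (1 - δ / (K + 1)) ^ K * (1 - δ / 2) := by
  have hK' : (0 : ℝ) < K := by exact_mod_cast hK
  have hpow : Real.exp (-δ) ≤ (1 - δ / (K + 1)) ^ K := by
    have h1 : Real.exp (-δ) = Real.exp (-(δ / K)) ^ K := by
      rw [← Real.exp_nat_mul]
      congr 1
      field_simp
    rw [h1]
    gcongr
    rw [Real.exp_neg]
    refine inv_le_of_inv_le₀ (by rw [sub_pos, div_lt_one (by positivity)]; linarith) ?_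
    refine le_trans ?_ (Real.add_one_le_exp _)
    have h2 : (1 : ℝ) - δ / (K + 1) = (K + 1 - δ) / (K + 1) := by field_simp
    rw [h2, inv_div, div_add_one hK'.ne', div_le_div_iff₀ (by linarith) hK']
    nlinarith
  refine le_trans ?_ (mul_le_mul_of_nonneg_right hpow (by linarith))
  have h2 : Real.exp (2 / 3) ≤ 2 := by
    have h : Real.exp (2 / 3) ^ 3 ≤ 2 ^ 3 := by
      rw [← Real.exp_nat_mul]
      have h1 : Real.exp ((3 : ℕ) * (2 / 3)) = Real.exp 1 ^ 2 := by
        rw [← Real.exp_nat_mul]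
        norm_num
      rw [h1]
      calc Real.exp 1 ^ 2 ≤ 2.7182818286 ^ 2 := by
            gcongr
            exact Real.exp_one_lt_d9.le
        _ ≤ _ := by norm_num
    exact le_of_pow_le_pow_left₀ (by norm_num) (by norm_num) h
  -- `exp u * (1 - u) ≤ 1` at `u = δ - 2 / 3`; with `exp (2 / 3) ≤ 2` it bounds `exp δ`
  have hu : Real.exp (δ - 2 / 3) * (5 / 3 - δ) ≤ 1 := by
    have := Real.add_one_le_exp (-(δ - 2 / 3))
    calc Real.exp (δ - 2 / 3) * (5 / 3 - δ) ≤
          Real.exp (δ - 2 / 3) * Real.exp (-(δ - 2 / 3)) := by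
            gcongr
            linarith
      _ = 1 := by rw [← Real.exp_add]; simp
  have hexp : Real.exp δ * (1 - δ) ≤ 1 - δ / 2 := by
    have h3 : Real.exp δ ≤ 2 * Real.exp (δ - 2 / 3) := by
      have : Real.exp δ = Real.exp (2 / 3) * Real.exp (δ - 2 / 3) := by
        rw [← Real.exp_add]
        ring_nf
      rw [this]
      gcongr
    have h4 : Real.exp δ * (5 / 3 - δ) ≤ 2 := by nlinarith
    have h5 : Real.exp δ * (1 - δ) * (5 / 3 - δ) ≤ (1 - δ / 2) * (5 / 3 - δ) := by nlinarith
    exact le_of_mul_le_mul_right h5 (by linarith)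
  calc 1 - δ = Real.exp (-δ) * (Real.exp δ * (1 - δ)) := by
        rw [← mul_assoc, ← Real.exp_add]
        simp
    _ ≤ _ := by gcongr

/-- Uniform bound on the tail of `R` under `μ` by the fraction of independent points that exceed the
threshold and survive a thinning. The point `f k (x k)` survives when `x k ∈ G k`; by `hthin` this has
conditional probability at least `1 - δ / (K + 1)`. -/
theorem measureReal_exists_thinned_count_add_lt_le {K : ℕ} (hK : 0 < K) {E : Type*} [MeasurableSpace E]
    {α : Fin K → Type*} [∀ k, MeasurableSpace (α k)]
    (μ : Measure E) [IsProbabilityMeasure μ]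
    (ν : ∀ k, Measure (α k)) [∀ k, IsProbabilityMeasure (ν k)]
    {f : ∀ k, α k → E} (hf : ∀ k, Measurable (f k)) {G : ∀ k, Set (α k)}
    (hG : ∀ k, MeasurableSet (G k)) {R : E → ℝ} (hR : Measurable R) {δ : ℝ} (hδ : 0 < δ)
    (hδ1 : δ ≤ 1)
    (hthin : ∀ k, ENNReal.ofReal (1 - δ / (K + 1)) • μ ≤ ((ν k).restrict (G k)).map (f k)) :
    (Measure.pi ν).real {x | ∃ t, (1 / (K : ℝ)) *
        ∑ k, (f k ⁻¹' {e | t ≤ R e} ∩ G k).indicator (fun _ => (1 : ℝ)) (x k) +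
        Real.sqrt (Real.log (2 * (K + 1) / δ) / (2 * K)) < μ.real {e | t ≤ R e}} ≤ δ := by
  have hK' : (0 : ℝ) < K := by exact_mod_cast hK
  set ε := Real.sqrt (Real.log (2 * (K + 1) / δ) / (2 * K)) with hε
  have hε0 : 0 ≤ ε := Real.sqrt_nonneg _
  have hexp : Real.exp (-2 * K * ε ^ 2) = δ / (2 * (K + 1)) := by
    have h1 : 1 ≤ 2 * (K + 1) / δ := by
      rw [le_div_iff₀ hδ]
      linarith
    rw [hε, Real.sq_sqrt (div_nonneg (Real.log_nonneg h1) (by positivity))]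
    have : -2 * (K : ℝ) * (Real.log (2 * (K + 1) / δ) / (2 * K)) =
        -Real.log (2 * (K + 1) / δ) := by
      field_simp
    rw [this, Real.exp_neg, Real.exp_log (by positivity), inv_div]
  have hp0 : 0 ≤ δ / (K + 1) := by positivity
  have hp1 : δ / (K + 1) ≤ 1 := by
    rw [div_le_one (by positivity)]
    linarith
  have hT : ∀ t, MeasurableSet {e | t ≤ R e} := fun t => measurableSet_le measurable_const hR
  have hTanti : Antitone fun t => {e | t ≤ R e} := fun t t' h e (he : t' ≤ R e) => h.trans he
  have hSanti : Antitone fun t => μ.real {e | t ≤ R e} := fun t t' h =>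
    measureReal_mono (hTanti h)
  rcases le_or_gt δ (2 / 3) with hδ2 | hδ2
  · -- small `δ`: the thinned indicators are independent with slightly smaller means
    have h := measureReal_exists_count_add_lt_le hK ν
      (A := fun k t => f k ⁻¹' {e | t ≤ R e} ∩ G k)
      (fun k t => (hf k (hT t)).inter (hG k))
      (fun k t t' h => Set.inter_subset_inter_left _ (Set.preimage_mono (hTanti h)))
      hSanti (fun t => measureReal_le_one) hε0 hp0 (fun k t => by
        have := hthin k {e | t ≤ R e}
        rw [Measure.map_apply (hf k) (hT t), Measure.restrict_apply (hf k (hT t)),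
          Measure.smul_apply, smul_eq_mul] at this
        have := ENNReal.toReal_mono (measure_ne_top _ _) this
        rwa [ENNReal.toReal_mul, ENNReal.toReal_ofReal (by linarith)] at this)
    refine h.trans ?_
    rw [Real.exp_add, hexp]
    rcases le_or_gt 1 ε with h1 | h1
    · rw [Nat.ceil_eq_zero.2 (mul_nonpos_of_nonneg_of_nonpos hK'.le (by linarith))]
      simpa using hδ.le
    have hceil := (Nat.ceil_lt_add_one (mul_nonneg hK'.le (sub_nonneg.2 h1.le))).le
    -- with this `x` the bound `K * (1 - ε) + 1` on the prefactor is `(K + 1) * (1 - x)`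
    set x := ε * K / (K + 1) with hx
    have hx1 : (K : ℝ) * (1 - ε) + 1 = (K + 1) * (1 - x) := by
      rw [hx]
      field_simp
      ring
    have hx2 : 4 * K * ε * (δ / (K + 1)) = 4 * δ * x := by
      rw [hx]
      ring
    rw [hx2]
    rw [hx1] at hceil
    calc _ ≤ ((K + 1) * (1 - x)) * (δ / (2 * (K + 1)) * Real.exp (4 * δ * x)) := by gcongr
      _ = δ / 2 * ((1 - x) * Real.exp (4 * δ * x)) := by field_simp
      _ ≤ δ / 2 * 2 := by
        gcongr
        exact one_sub_mul_exp_le_two hδ2 (by positivity)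
      _ = δ := by ring
  · -- large `δ`: no thinning occurs with probability at least `(1 - δ / (K + 1)) ^ K`
    set B : Set (Fin K → E) := {y | ∃ t, (1 / (K : ℝ)) *
        ∑ k, ({e | t ≤ R e}).indicator (fun _ => (1 : ℝ)) (y k) + ε < μ.real {e | t ≤ R e}}
      with hB
    have hBle : (Measure.pi fun _ : Fin K => μ).real B ≤ δ / 2 := by
      have h := measureReal_exists_count_add_lt_le hK (fun _ => μ)
        (A := fun _ t => {e | t ≤ R e}) (fun _ => hT) (fun _ => hTanti) hSanti
        (fun t => measureReal_le_one) hε0 le_rfl (fun k t => by simp)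
      refine h.trans ?_
      rw [mul_zero, add_zero, hexp]
      have hceil : (⌈(K : ℝ) * (1 - ε)⌉₊ : ℝ) ≤ K + 1 := by
        have : ⌈(K : ℝ) * (1 - ε)⌉₊ ≤ K := Nat.ceil_le.2 (by nlinarith)
        have : (⌈(K : ℝ) * (1 - ε)⌉₊ : ℝ) ≤ K := by exact_mod_cast this
        linarith
      calc _ ≤ ((K : ℝ) + 1) * (δ / (2 * (K + 1))) := by gcongr
        _ = δ / 2 := by field_simp
    set Q := Measure.pi fun _ : Fin K => μ with hQ
    -- `B` is an uncountable union over `t`, so it is replaced by a measurable superset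
    set M := toMeasurable Q B with hM
    have hMm : MeasurableSet M := measurableSet_toMeasurable _ _
    have hMle : Q.real M ≤ δ / 2 := by
      rwa [measureReal_def, hM, measure_toMeasurable]
    set F : (∀ k, α k) → Fin K → E := fun x k => f k (x k) with hF
    have hFm : Measurable F := measurable_pi_lambda _ fun k => (hf k).comp (measurable_pi_apply k)
    have hgood : (1 - δ / (K + 1)) ^ K * (1 - δ / 2) ≤
        (Measure.pi ν).real (F ⁻¹' Mᶜ ∩ Set.univ.pi G) := by
      have hdom := smul_pi_le_pi (fun _ : Fin K => μ)
        (fun k => ((ν k).restrict (G k)).map (f k)) hthin Mᶜ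
      rw [← Measure.pi_map_pi fun k => (hf k).aemeasurable, ← Measure.restrict_pi_pi,
        Measure.map_apply hFm hMm.compl, Measure.restrict_apply (hFm hMm.compl),
        Measure.smul_apply, smul_eq_mul, Fintype.card_fin] at hdom
      have := ENNReal.toReal_mono (measure_ne_top _ _) hdom
      rw [ENNReal.toReal_mul, ENNReal.toReal_pow, ENNReal.toReal_ofReal (by linarith)] at this
      refine le_trans ?_ this
      gcongr
      have := probReal_compl_eq_one_sub (μ := Q) hMm
      change _ ≤ Q.real Mᶜ
      linarith
    have hGm : MeasurableSet (F ⁻¹' Mᶜ ∩ Set.univ.pi G) :=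
      (hFm hMm.compl).inter (MeasurableSet.univ_pi hG)
    have hcompl := probReal_compl_eq_one_sub (μ := Measure.pi ν) hGm
    have hfin := one_sub_le_pow_mul hK hδ2.le hδ1
    refine le_trans (measureReal_mono (s₂ := (F ⁻¹' Mᶜ ∩ Set.univ.pi G)ᶜ) ?_
      (measure_ne_top _ _)) (by linarith)
    rintro x ⟨t, ht⟩ ⟨hxM, hxG⟩
    refine hxM (subset_toMeasurable Q B ⟨t, ?_⟩)
    convert ht using 5 with k
    have hxk : x k ∈ G k := hxG k (Set.mem_univ k)
    by_cases hk : t ≤ R (f k (x k)) <;> simp [Set.indicator, hF, hxk, hk]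

/-! ### Query values of the clients -/

instance isMarkovKernel_iidKernel (Z : Type*) [MeasurableSpace Z] (n : ℕ) :
    IsMarkovKernel (iidKernel Z n) :=
  ⟨fun P => by
    change IsProbabilityMeasure (Measure.pi fun _ : Fin n => (P : Measure Z))
    infer_instance⟩

instance isProbabilityMeasure_clientLaw {Z : Type*} [MeasurableSpace Z]
    (μ : Measure (ProbabilityMeasure Z)) [IsProbabilityMeasure μ] (n : ℕ) :
    IsProbabilityMeasure (clientLaw μ n) := by
  unfold clientLaw
  infer_instance

section Risk

variable {X Y : Type*} [MeasurableSpace X] [MeasurableSpace Y] {h : X → Y} {loss : Y → Y → ℝ}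

theorem measurable_risk (hm : Measurable fun z : X × Y => loss z.2 (h z.1)) :
    Measurable fun P : ProbabilityMeasure (X × Y) => risk loss h (P : Measure (X × Y)) :=
  (hm.stronglyMeasurable.integral_kernel (κ := ⟨_, measurable_subtype_coe⟩)).measurable

theorem queryValue_eq_sum (hm : Measurable fun z : X × Y => loss z.2 (h z.1)) {n : ℕ}
    (D : Fin n → X × Y) :
    queryValue loss h D = (n : ℝ)⁻¹ * ∑ i, loss (D i).2 (h (D i).1) := by
  have hint : ∀ i, Integrable (fun z : X × Y => loss z.2 (h z.1)) (Measure.dirac (D i)) :=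
    fun i => integrable_dirac' hm.stronglyMeasurable (by simp)
  rw [queryValue, risk, empiricalDistribution, integral_smul_measure,
    integral_finsetSum_measure fun i _ => hint i]
  simp [integral_dirac' _ _ hm.stronglyMeasurable]

theorem measurable_queryValue (hm : Measurable fun z : X × Y => loss z.2 (h z.1)) (n : ℕ) :
    Measurable fun D : Fin n → X × Y => queryValue loss h D := by
  simp only [queryValue_eq_sum hm]
  exact (Finset.measurable_sum _ fun i _ => hm.comp (measurable_pi_apply i)).const_mul _

theorem queryValue_mem_Icc (hm : Measurable fun z : X × Y => loss z.2 (h z.1))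
    (hb : ∀ y y', 0 ≤ loss y y' ∧ loss y y' ≤ 1) {n : ℕ} (D : Fin n → X × Y) :
    queryValue loss h D ∈ Set.Icc (0 : ℝ) 1 := by
  rw [queryValue_eq_sum hm]
  refine ⟨mul_nonneg (by positivity) (Finset.sum_nonneg fun i _ => (hb _ _).1), ?_⟩
  have hsum : ∑ i, loss (D i).2 (h (D i).1) ≤ n := by
    simpa using Finset.sum_le_sum (s := Finset.univ) fun i _ => (hb (D i).2 (h (D i).1)).2
  calc _ ≤ (n : ℝ)⁻¹ * n := by gcongr
    _ ≤ 1 := inv_mul_le_one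

theorem integral_queryValue_pi (hm : Measurable fun z : X × Y => loss z.2 (h z.1))
    (hb : ∀ y y', 0 ≤ loss y y' ∧ loss y y' ≤ 1) {n : ℕ} (hn : 0 < n)
    (P : Measure (X × Y)) [IsProbabilityMeasure P] :
    ∫ D, queryValue loss h D ∂(Measure.pi fun _ : Fin n => P) = risk loss h P := by
  simp only [queryValue_eq_sum hm]
  rw [integral_const_mul, integral_finsetSum]
  · have : ∀ i, ∫ D : Fin n → X × Y, loss (D i).2 (h (D i).1) ∂(Measure.pi fun _ => P) =
        risk loss h P := fun i =>
      integral_comp_eval (μ := fun _ : Fin n => P) (i := i)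
        (f := fun z : X × Y => loss z.2 (h z.1)) hm.aestronglyMeasurable
    simp only [this]
    have hn' : (n : ℝ) ≠ 0 := by positivity
    simp [hn']
  · intro i _
    exact Integrable.of_mem_Icc 0 1 (hm.comp (measurable_pi_apply i)).aemeasurable
      (ae_of_all _ fun D => hb _ _)

theorem integral_queryValue_clientLaw (hm : Measurable fun z : X × Y => loss z.2 (h z.1))
    (hb : ∀ y y', 0 ≤ loss y y' ∧ loss y y' ≤ 1) {n : ℕ} (hn : 0 < n)
    (μ : Measure (ProbabilityMeasure (X × Y))) [IsProbabilityMeasure μ] :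
    ∫ q, queryValue loss h q.2 ∂clientLaw μ n =
      ∫ Q, risk loss h (Q : Measure (X × Y)) ∂μ := by
  rw [clientLaw, Measure.integral_compProd]
  · exact integral_congr_ae (ae_of_all _ fun P => integral_queryValue_pi hm hb hn _)
  · exact Integrable.of_mem_Icc 0 1
      ((measurable_queryValue hm n).comp measurable_snd).aemeasurable
      (ae_of_all _ fun q => queryValue_mem_Icc hm hb q.2)

theorem measureReal_queryValue_lt_le (hm : Measurable fun z : X × Y => loss z.2 (h z.1))
    (hb : ∀ y y', 0 ≤ loss y y' ∧ loss y y' ≤ 1) {n : ℕ} (hn : 0 < n)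
    (P : Measure (X × Y)) [IsProbabilityMeasure P] {s : ℝ} (hs : 0 ≤ s) :
    (Measure.pi fun _ : Fin n => P).real {D | queryValue loss h D < risk loss h P - s} ≤
      Real.exp (-2 * n * s ^ 2) := by
  have hn' : (0 : ℝ) < n := by exact_mod_cast hn
  have hind : iIndepFun (fun i (D : Fin n → X × Y) => loss (D i).2 (h (D i).1))
      (Measure.pi fun _ : Fin n => P) :=
    iIndepFun_pi (X := fun _ (z : X × Y) => loss z.2 (h z.1)) fun _ => hm.aemeasurable
  have hint : ∀ i, ∫ D : Fin n → X × Y, loss (D i).2 (h (D i).1) ∂(Measure.pi fun _ => P) =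
      risk loss h P := fun i =>
    integral_comp_eval (μ := fun _ : Fin n => P) (i := i)
      (f := fun z : X × Y => loss z.2 (h z.1)) hm.aestronglyMeasurable
  have hH := measureReal_sum_le_sub_le_exp (s := n * s)
    (fun i => (hm.comp (measurable_pi_apply i)).aemeasurable) (fun i D => hb _ _) hind
    (by positivity)
  refine (measureReal_mono ?_).trans (hH.trans (Real.exp_le_exp.2 (le_of_eq ?_)))
  · intro D hD
    simp only [Set.mem_ofPred_eq, queryValue_eq_sum hm] at hD
    rw [inv_mul_lt_iff₀ hn'] at hD
    have : ∑ i : Fin n, ∫ D : Fin n → X × Y, loss (D i).2 (h (D i).1) ∂(Measure.pi fun _ => P) =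
        n * risk loss h P := by
      simp [hint]
    change ∑ i, loss (D i).2 (h (D i).1) ≤
      ∑ i : Fin n, ∫ D : Fin n → X × Y, loss (D i).2 (h (D i).1) ∂(Measure.pi fun _ => P) - n * s
    rw [this]
    linarith
  · rw [Fintype.card_fin]
    field_simp

/-- Given its data distribution, a client has query value at least its risk minus `s` with probability
at least `1 - exp (-2 n s ^ 2)`, expressed as a domination of measures. -/
theorem smul_le_map_fst_restrict_clientLaw
    (hm : Measurable fun z : X × Y => loss z.2 (h z.1))
    (hb : ∀ y y', 0 ≤ loss y y' ∧ loss y y' ≤ 1) {n : ℕ} (hn : 0 < n)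
    (μ : Measure (ProbabilityMeasure (X × Y))) [IsProbabilityMeasure μ] {s : ℝ} (hs : 0 ≤ s) :
    ENNReal.ofReal (1 - Real.exp (-2 * n * s ^ 2)) • μ ≤
      ((clientLaw μ n).restrict {q | risk loss h (q.1 : Measure (X × Y)) - s ≤
        queryValue loss h q.2}).map Prod.fst := by
  have hG : MeasurableSet {q : ProbabilityMeasure (X × Y) × (Fin n → X × Y) |
      risk loss h (q.1 : Measure (X × Y)) - s ≤ queryValue loss h q.2} :=
    measurableSet_le (((measurable_risk hm).comp measurable_fst).sub_const _)
      ((measurable_queryValue hm n).comp measurable_snd)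
  refine Measure.le_iff.2 fun E hE => ?_
  rw [Measure.map_apply measurable_fst hE, Measure.restrict_apply (measurable_fst hE),
    clientLaw, Measure.compProd_apply ((measurable_fst hE).inter hG), Measure.smul_apply,
    smul_eq_mul, ← setLIntegral_const, ← lintegral_indicator hE]
  refine lintegral_mono fun P => ?_
  by_cases hP : P ∈ E
  · have hD : MeasurableSet {D : Fin n → X × Y | risk loss h (P : Measure (X × Y)) - s ≤
        queryValue loss h D} := measurableSet_le measurable_const (measurable_queryValue hm n)
    have h1 := measureReal_queryValue_lt_le hm hb hn (P : Measure (X × Y)) hs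
    have h2 := probReal_compl_eq_one_sub (μ := Measure.pi fun _ : Fin n => (P : Measure (X × Y))) hD
    have h3 : {D : Fin n → X × Y | risk loss h (P : Measure (X × Y)) - s ≤
        queryValue loss h D}ᶜ = {D | queryValue loss h D < risk loss h (P : Measure (X × Y)) - s} := by
      ext D
      exact not_le (α := ℝ)
    rw [h3] at h2
    rw [Set.indicator_of_mem hP]
    have h4 : Prod.mk P ⁻¹' (Prod.fst ⁻¹' E ∩ {q : ProbabilityMeasure (X × Y) × (Fin n → X × Y) |
        risk loss h (q.1 : Measure (X × Y)) - s ≤ queryValue loss h q.2}) =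
        {D | risk loss h (P : Measure (X × Y)) - s ≤ queryValue loss h D} := by
      ext D
      simp [hP]
    rw [h4]
    refine ENNReal.ofReal_le_of_le_toReal ?_
    change _ ≤ (Measure.pi fun _ : Fin n => (P : Measure (X × Y))).real _
    linarith
  · simp [Set.indicator_of_notMem hP]

/-- Hoeffding's inequality over the clients: unconditionally, the query values have mean
`∫ risk dμ`, whatever the sample sizes. -/
theorem measureReal_sum_queryValue_le_le_exp
    (hm : Measurable fun z : X × Y => loss z.2 (h z.1))
    (hb : ∀ y y', 0 ≤ loss y y' ∧ loss y y' ≤ 1)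
    (μ : Measure (ProbabilityMeasure (X × Y))) [IsProbabilityMeasure μ] {K : ℕ} {n : Fin K → ℕ}
    (hn : ∀ k, 0 < n k) {Ω : Type*} [MeasurableSpace Ω] {Pr : Measure Ω} [IsProbabilityMeasure Pr]
    {V : (k : Fin K) → Ω → ProbabilityMeasure (X × Y) × (Fin (n k) → X × Y)}
    (hlaw : ∀ k, HasLaw (V k) (clientLaw μ (n k)) Pr) (hind : iIndepFun V Pr)
    {s : ℝ} (hs : 0 ≤ s) :
    Pr.real {ω | ∑ k, queryValue loss h (V k ω).2 ≤
      K * ∫ Q, risk loss h (Q : Measure (X × Y)) ∂μ - s} ≤ Real.exp (-2 * s ^ 2 / K) := by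
  have hqm : ∀ k, Measurable fun q : ProbabilityMeasure (X × Y) × (Fin (n k) → X × Y) =>
      queryValue loss h q.2 := fun k => (measurable_queryValue hm (n k)).comp measurable_snd
  have hint : ∀ k, ∫ ω, queryValue loss h (V k ω).2 ∂Pr =
      ∫ Q, risk loss h (Q : Measure (X × Y)) ∂μ := fun k =>
    ((hlaw k).integral_comp (hqm k).aestronglyMeasurable).trans
      (integral_queryValue_clientLaw hm hb (hn k) μ)
  have hae : ∀ k, AEMeasurable (fun ω => queryValue loss h (V k ω).2) Pr := fun k =>
    (hqm k).comp_aemeasurable (hlaw k).aemeasurable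
  have hH := measureReal_sum_le_sub_le_exp hae (fun k ω => queryValue_mem_Icc hm hb _)
    (hind.comp (fun k q => queryValue loss h q.2) hqm) hs
  simpa [hint] using hH

end Risk

/-! ### Guarantees for the meta-distribution -/

/-- The event `s` need not be measurable. -/
theorem one_sub_le_measureReal_of_compl_le {Ω : Type*} [MeasurableSpace Ω] {Pr : Measure Ω}
    [IsProbabilityMeasure Pr] {s : Set Ω} {δ : ℝ} (h : Pr.real sᶜ ≤ δ) : 1 - δ ≤ Pr.real s := by
  have h1 := measureReal_union_le (μ := Pr) s sᶜ
  rw [Set.union_compl_self, probReal_univ] at h1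
  linarith

theorem mainTheorem5 :
    ∃ C : ℝ, 0 < C ∧
      ∀ (X : Type*) (Y : Type*) [MeasurableSpace X] [MeasurableSpace Y]
        -- a meta-distribution, a model, and a loss with values in `[0, 1]`
        (μ : Measure (ProbabilityMeasure (X × Y))) [IsProbabilityMeasure μ]
        (h : X → Y) (loss : Y → Y → ℝ)
        (_ : Measurable fun z : X × Y => loss z.2 (h z.1))
        (_ : ∀ y y', 0 ≤ loss y y' ∧ loss y y' ≤ 1)
        -- `K` independent clients, client `k` having `n k` samples
        (K : ℕ) (_ : 1 ≤ K) (n : Fin K → ℕ) (_ : ∀ k, 1 ≤ n k)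
        (Ω : Type*) [MeasurableSpace Ω] (Pr : Measure Ω) [IsProbabilityMeasure Pr]
        (P : Fin K → Ω → ProbabilityMeasure (X × Y)) (D : (k : Fin K) → Ω → Fin (n k) → X × Y)
        (_ : ∀ k, HasLaw (fun ω => (P k ω, D k ω)) (clientLaw μ (n k)) Pr)
        (_ : iIndepFun (fun k ω => (P k ω, D k ω)) Pr)
        (δ : ℝ) (_ : 0 < δ),
        -- the mean risk
        1 - δ ≤ Pr.real {ω |
          ∫ Q, risk loss h (Q : Measure (X × Y)) ∂μ ≤
            (1 / (K : ℝ)) * ∑ k, queryValue loss h (D k ω) +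
              Real.sqrt (Real.log (K / δ)) *
                (C * (1 / Real.sqrt K + (1 / (K : ℝ)) * ∑ k, 1 / Real.sqrt (n k)))} ∧
        -- the tail of the risk, uniformly in the threshold
        1 - δ ≤ Pr.real {ω | ∀ t : ℝ,
          μ.real {Q | t ≤ risk loss h (Q : Measure (X × Y))} ≤
            (1 / (K : ℝ)) * ∑ k, (if t - Real.sqrt (Real.log ((K + 1) / δ) / (2 * n k)) ≤
                queryValue loss h (D k ω) then (1 : ℝ) else 0) +
              Real.sqrt (Real.log (2 * (K + 1) / δ) / (2 * K))} := by
  refine ⟨1, one_pos, ?_⟩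
  intro X Y _ _ μ _ h loss hm hb K hK n hn Ω _ Pr _ P D hlaw hind δ hδ
  have hK' : (1 : ℝ) ≤ K := by exact_mod_cast hK
  rcases lt_or_ge 1 δ with hδ1 | hδ1
  · exact ⟨(by linarith : 1 - δ ≤ 0).trans measureReal_nonneg,
      (by linarith : 1 - δ ≤ 0).trans measureReal_nonneg⟩
  constructor
  · refine one_sub_le_measureReal_of_compl_le ?_
    set m := ∫ Q, risk loss h (Q : Measure (X × Y)) ∂μ
    have hlog : 0 ≤ Real.log (1 / δ) := Real.log_nonneg (by rwa [le_div_iff₀ hδ, one_mul])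
    have hH := measureReal_sum_queryValue_le_le_exp hm hb μ hn hlaw hind
      (Real.sqrt_nonneg (Real.log (1 / δ) * K / 2))
    have hexp : Real.exp (-2 * Real.sqrt (Real.log (1 / δ) * K / 2) ^ 2 / K) = δ := by
      rw [Real.sq_sqrt (by positivity)]
      have : -2 * (Real.log (1 / δ) * K / 2) / K = Real.log δ := by
        rw [one_div, Real.log_inv]
        field_simp
      rw [this, Real.exp_log hδ]
    rw [hexp] at hH
    refine (measureReal_mono ?_).trans hH
    intro ω hω
    simp only [Set.mem_compl_iff, Set.mem_ofPred_eq, not_le] at hω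
    simp only [Set.mem_ofPred_eq]
    have h1 : Real.sqrt (Real.log (1 / δ) * K / 2) ≤
        K * (Real.sqrt (Real.log (K / δ)) *
          (1 * (1 / Real.sqrt K + (1 / (K : ℝ)) * ∑ k, 1 / Real.sqrt (n k)))) := by
      calc Real.sqrt (Real.log (1 / δ) * K / 2) ≤ Real.sqrt (Real.log (K / δ) * K) := by
            refine Real.sqrt_le_sqrt ?_
            have : Real.log (1 / δ) ≤ Real.log (K / δ) :=
              Real.log_le_log (by positivity) (by gcongr)
            nlinarith
        _ = K * (Real.sqrt (Real.log (K / δ)) * (1 * (1 / Real.sqrt K + 0))) := by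
            rw [Real.sqrt_mul' _ (by positivity)]
            have hpos : 0 < Real.sqrt K := Real.sqrt_pos.2 (by linarith)
            field_simp
            rw [Real.sq_sqrt (by positivity)]
            ring
        _ ≤ _ := by
            gcongr
            positivity
    have h2 := mul_lt_mul_of_pos_left hω (by linarith : (0 : ℝ) < K)
    rw [mul_add, ← mul_assoc, mul_one_div_cancel (by linarith), one_mul] at h2
    linarith
  · refine one_sub_le_measureReal_of_compl_le ?_
    set s : Fin K → ℝ := fun k => Real.sqrt (Real.log ((K + 1) / δ) / (2 * n k)) with hs
    have hexp : ∀ k, Real.exp (-2 * n k * s k ^ 2) = δ / (K + 1) := by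
      intro k
      have hnk : (0 : ℝ) < n k := by exact_mod_cast hn k
      have hlog : 0 ≤ Real.log ((K + 1) / δ) :=
        Real.log_nonneg (by rw [le_div_iff₀ hδ]; linarith)
      rw [hs, Real.sq_sqrt (by positivity)]
      have : -2 * (n k : ℝ) * (Real.log ((K + 1) / δ) / (2 * n k)) =
          -Real.log ((K + 1) / δ) := by
        field_simp
      rw [this, Real.exp_neg, Real.exp_log (by positivity), inv_div]
    have htail := measureReal_exists_thinned_count_add_lt_le hK μ (fun k => clientLaw μ (n k))
      (f := fun k => Prod.fst) (fun k => measurable_fst)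
      (G := fun k => {q | risk loss h (q.1 : Measure (X × Y)) - s k ≤ queryValue loss h q.2})
      (fun k => measurableSet_le (((measurable_risk hm).comp measurable_fst).sub_const _)
        ((measurable_queryValue hm (n k)).comp measurable_snd))
      (measurable_risk hm) hδ hδ1 (fun k => by
        rw [← hexp k]
        exact smul_le_map_fst_restrict_clientLaw hm hb (hn k) μ (Real.sqrt_nonneg _))
    -- the exceptional set may be non-measurable, but passing to the law can only enlarge its measure
    have hjoint : Pr.map (fun ω k => (P k ω, D k ω)) =
        Measure.pi fun k => clientLaw μ (n k) := by
      rw [hind.map_fun_eq_pi_map fun k => (hlaw k).aemeasurable]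
      simp only [(hlaw _).map_eq]
    rw [← hjoint] at htail
    refine le_trans ?_ htail
    refine le_trans (measureReal_mono ?_ (measure_ne_top _ _)) (ENNReal.toReal_mono ?_
      (Measure.le_map_apply (aemeasurable_pi_lambda _ fun k => (hlaw k).aemeasurable) _))
    · -- a good client of risk at least `t` is counted at the threshold `t`
      intro ω hω
      simp only [Set.mem_compl_iff, Set.mem_ofPred_eq, not_forall, not_le] at hω
      obtain ⟨t, ht⟩ := hω
      refine ⟨t, lt_of_le_of_lt ?_ ht⟩
      gcongr with k
      split_ifs with h1
      · exact Set.indicator_le_self' (fun _ _ => zero_le_one) _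
      · exact (Set.indicator_of_notMem
          (fun h2 => h1 ((sub_le_sub_right h2.1 _).trans h2.2)) _).le
    · rw [hjoint]
      exact measure_ne_top _ _
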